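/- Let $\Phi\in\mathbb{R}^{M\times N}$, $y\in\mathbb{R}^M$, and let $k,\nu,\lambda,\eta,\mu>0$. Let $\rho$ be Huber's penalty, $$\rho(r)=\begin{cases} r^2/2, & |r|\le k\nu^2,\\ -\tfrac{k^2\nu^4}{2}+k\nu^2|r|, & |r|>k\nu^2,\end{cases}\qquad \psi(r)=\rho'(r)=\begin{cases} r, & |r|\le k\nu^2,\\ k\nu^2\,\mathrm{sgn}(r), & |r|>k\nu^2,\end{cases}$$ and let $g(x)=\sum_{i=1}^M\rho\big(y_i-(\Phi x)_i\big)$. The robust compressed sensing problem is $$\min_{x\in\mathbb{R}^N}\ g(x)+\lambda\|x\|_1. \qquad (\ast)$$ From arbitrary $x^0,z^0,u^0\in\mathbb{R}^N$, let the sequences $x^n,z^n,u^n\in\mathbb{R}^N$ be generated, for $n=0,1,2,\dots$, by the inexact (generalized) ADMM $$x^{n+1}=(\mu\Phi^T\Phi+\eta I)^{-1}\big(\mu\Phi^T v^n+\eta(z^n-u^n)\big),\qquad v^n=\mu^{-1}\psi(y-\Phi x^n)+\Phi x^n,$$ $$z^{n+1}=\arg\min_{z\in\mathbb{R}^N}\Big\{\lambda\|z\|_1+\tfrac{\eta}{2}\|x^{n+1}-z+u^n\|_2^2\Big\},\qquad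 u^{n+1}=u^n+x^{n+1}-z^{n+1},$$ where $\psi$ acts componentwise (the $z$-step is soft-thresholding of $x^{n+1}+u^n$ at level $\lambda/\eta$). Let $x^{n+1}_*$ be the exact solution of the $x$-step, $$x_*^{n+1}=\arg\min_{x\in\mathbb{R}^N}\Big\{g(x)+\tfrac{\eta}{2}\|x-z^n+u^n\|_2^2\Big\}.$$ If $\sum_{n=0}^\infty\|x^{n+1}-x^{n+1}_*\|_2<\infty$, then the sequence $(x^n)$ converges to a solution (a global minimizer) of $(\ast)$. -/

import Mathlib

open Filter Topology Matrix

noncomputable section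

namespace RobustCS

/-- Huber's penalty `ρ` (soft limiter) with threshold `k ν²`. -/
def huber (k ν r : ℝ) : ℝ :=
  if |r| ≤ k * ν ^ 2 then r ^ 2 / 2 else -(k ^ 2 * ν ^ 4) / 2 + k * ν ^ 2 * |r|

/-- The derivative `ψ = ρ'` of Huber's penalty. -/
def huberPsi (k ν r : ℝ) : ℝ :=
  if |r| ≤ k * ν ^ 2 then r else k * ν ^ 2 * Real.sign r

/-- The robust loss `g(x) = ∑ᵢ ρ(yᵢ - (Φ x)ᵢ)`. -/
def robustLoss {M N : ℕ} (k ν : ℝ) (Φ : Matrix (Fin M) (Fin N) ℝ)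
    (y : EuclideanSpace ℝ (Fin M)) (x : EuclideanSpace ℝ (Fin N)) : ℝ :=
  ∑ i, huber k ν (y i - (Φ *ᵥ x.ofLp) i)

/-- The `ℓ¹` norm. -/
def l1Norm {N : ℕ} (x : EuclideanSpace ℝ (Fin N)) : ℝ := ∑ j, |x j|

/-- `x` solves the robust compressed sensing problem: it minimizes `g + λ ‖·‖₁` over `ℝᴺ`. -/
def IsSolution {M N : ℕ} (k ν lam : ℝ) (Φ : Matrix (Fin M) (Fin N) ℝ)
    (y : EuclideanSpace ℝ (Fin M)) (x : EuclideanSpace ℝ (Fin N)) : Prop :=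
  ∀ x' : EuclideanSpace ℝ (Fin N),
    robustLoss k ν Φ y x + lam * l1Norm x ≤ robustLoss k ν Φ y x' + lam * l1Norm x'

/-- `xs` is an exact solution of the `x`-step at `(z, u)`:
it minimizes `g(x) + (η/2) ‖x - z + u‖²`. -/
def IsExactXStep {M N : ℕ} (k ν η : ℝ) (Φ : Matrix (Fin M) (Fin N) ℝ)
    (y : EuclideanSpace ℝ (Fin M)) (z u xs : EuclideanSpace ℝ (Fin N)) : Prop :=
  ∀ x' : EuclideanSpace ℝ (Fin N),
    robustLoss k ν Φ y xs + η / 2 * ‖xs - z + u‖ ^ 2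
      ≤ robustLoss k ν Φ y x' + η / 2 * ‖x' - z + u‖ ^ 2

/-- `zs` is the result of the `z`-step at `(x, u)`:
it minimizes `λ ‖z‖₁ + (η/2) ‖x - z + u‖²`. -/
def IsZStep {N : ℕ} (lam η : ℝ) (x u zs : EuclideanSpace ℝ (Fin N)) : Prop :=
  ∀ z' : EuclideanSpace ℝ (Fin N),
    lam * l1Norm zs + η / 2 * ‖x - zs + u‖ ^ 2 ≤ lam * l1Norm z' + η / 2 * ‖x - z' + u‖ ^ 2

/-- The centre `v = W⁻¹ ψ(y - Φ x) + Φ x` of the quadratic approximation of `g` at `x`,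
for the modified-residuals choice `W = μ I`. -/
def mrPoint {M N : ℕ} (k ν μ : ℝ) (Φ : Matrix (Fin M) (Fin N) ℝ)
    (y : EuclideanSpace ℝ (Fin M)) (x : EuclideanSpace ℝ (Fin N)) : EuclideanSpace ℝ (Fin M) :=
  WithLp.toLp 2 fun i => μ⁻¹ * huberPsi k ν (y i - (Φ *ᵥ x.ofLp) i) + (Φ *ᵥ x.ofLp) i

/-- The closed-form majorization update of the `x`-variable,
`(μ Φᵀ Φ + η I)⁻¹ (μ Φᵀ v + η (z - u))`, with `v` the centre at the current point `x`. -/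
def mmXUpdate {M N : ℕ} (k ν μ η : ℝ) (Φ : Matrix (Fin M) (Fin N) ℝ)
    (y : EuclideanSpace ℝ (Fin M)) (x z u : EuclideanSpace ℝ (Fin N)) :
    EuclideanSpace ℝ (Fin N) :=
  WithLp.toLp 2 ((μ • (Φᵀ * Φ) + η • (1 : Matrix (Fin N) (Fin N) ℝ))⁻¹ *ᵥ
    (μ • (Φᵀ *ᵥ (mrPoint k ν μ Φ y x).ofLp) + η • (z - u).ofLp))

end RobustCS

end

/-!
Put `h = λ‖·‖₁` and `w n = z (n+1) + u (n+1)`. Since `u (n+1) + z (n+1) = u n + x (n+1)`,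
the `z`-step says that `z (n+1)` is the proximal point of `h` at `w n`, and the exact `x`-step says that
`xs (n+2)` is the proximal point of `g` at the reflected point `2 z (n+1) - w n`. Hence
`w (n+1) = T (w n) + e n`, where `T` is the Douglas–Rachford operator of `g` and `h`, and
`e n = x (n+2) - xs (n+2)` is summable.

`T` is firmly nonexpansive around its fixed points (`douglasRachford_step`), so the distance from `w n` to
any fixed point is nonincreasing up to a summable error, hence converges, and `T (w n) - w n → 0`. In
finite dimension `w` has a cluster point; the subgradient inequalities pass to the limit, so the cluster
point is itself a fixed point, and the distance to it must converge to `0`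
(`exists_tendsto_of_inexact_douglasRachford`). The corresponding limit of `z` minimizes `g + h`, and `x` has
the same limit.

A fixed point of `T` amounts to a minimizer of `g + h` together with a subgradient of `h` there whose negative is a
subgradient of `g`. A minimizer exists because `g ≥ 0` and `‖·‖₁ ≥ ‖·‖₂` make `g + h` coercive; the
subgradient is provided by smoothness of Huber's penalty, in the form of the quadratic upper bound
`huber_le_quadratic`.
-/

open Filter Topology Matrix

namespace RobustCS

/-! ### Subgradients and proximal points -/

section Subgradient

variable {E : Type*} [NormedAddCommGroup E] [InnerProductSpace ℝ E]

/-- `s` is a subgradient of `f` at `p`. -/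
def IsSubgradient (f : E → ℝ) (p s : E) : Prop :=
  ∀ x, f p + inner ℝ s (x - p) ≤ f x

lemma IsSubgradient.inner_sub_nonneg {f : E → ℝ} {p q s t : E} (hs : IsSubgradient f p s)
    (ht : IsSubgradient f q t) : 0 ≤ inner ℝ (s - t) (p - q) := by
  have h1 := hs q
  have h2 := ht p
  have h3 : inner ℝ s (q - p) = - inner ℝ s (p - q) := by
    rw [← inner_neg_right, neg_sub]
  rw [inner_sub_left]
  linarith

lemma nonneg_of_forall_mul_add_sq_mul_nonneg {A C : ℝ}
    (h : ∀ t : ℝ, 0 < t → t ≤ 1 → 0 ≤ t * A + t ^ 2 * C) : 0 ≤ A := by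
  have h1 : Tendsto (fun t : ℝ => A + t * C) (𝓝[>] 0) (𝓝 (A + 0 * C)) :=
    (Continuous.tendsto (by fun_prop) 0).mono_left nhdsWithin_le_nhds
  rw [zero_mul, add_zero] at h1
  refine ge_of_tendsto h1 ?_
  filter_upwards [Ioc_mem_nhdsGT (zero_lt_one' ℝ)] with t ht
  have h2 := h t ht.1 ht.2
  have h3 : 0 ≤ t * (A + t * C) := by linarith
  exact nonneg_of_mul_nonneg_right h3 ht.1

lemma _root_.ConvexOn.map_add_smul_sub_le {f : E → ℝ} (hf : ConvexOn ℝ Set.univ f) (p x : E) {t : ℝ}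
    (h0 : 0 ≤ t) (h1 : t ≤ 1) : f (p + t • (x - p)) ≤ f p + t * (f x - f p) := by
  have h := hf.2 (Set.mem_univ p) (Set.mem_univ x) (sub_nonneg.2 h1) h0 (sub_add_cancel 1 t)
  have e : (1 - t) • p + t • x = p + t • (x - p) := by module
  rw [e] at h
  simp only [smul_eq_mul] at h
  linarith

/-- If `p` minimizes `φ + f` with `f` convex and `φ` bounded above by a quadratic expansion around `p`
with linear term `s`, then `-s` is a subgradient of `f` at `p`. -/
lemma isSubgradient_neg_of_isMin {φ f : E → ℝ} (hf : ConvexOn ℝ Set.univ f) {p s : E}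
    (hφ : ∀ d, ∃ C, ∀ t : ℝ, φ (p + t • d) ≤ φ p + t * inner ℝ s d + t ^ 2 * C)
    (hmin : ∀ x, φ p + f p ≤ φ x + f x) : IsSubgradient f p (-s) := by
  intro x
  obtain ⟨C, hC⟩ := hφ (x - p)
  have key : 0 ≤ inner ℝ s (x - p) + (f x - f p) := by
    refine nonneg_of_forall_mul_add_sq_mul_nonneg (C := C) fun t h0 h1 => ?_
    have h2 := hmin (p + t • (x - p))
    have h3 := hf.map_add_smul_sub_le p x h0.le h1
    linarith [hC t]
  rw [inner_neg_left]
  linarith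


lemma isSubgradient_of_prox {f : E → ℝ} (hf : ConvexOn ℝ Set.univ f) {η : ℝ} {p c : E}
    (hmin : ∀ x, f p + η / 2 * ‖p - c‖ ^ 2 ≤ f x + η / 2 * ‖x - c‖ ^ 2) :
    IsSubgradient f p (η • (c - p)) := by
  have h : IsSubgradient f p (-(η • (p - c))) := by
    refine isSubgradient_neg_of_isMin (φ := fun x => η / 2 * ‖x - c‖ ^ 2) hf (fun d => ?_)
      fun x => by linarith [hmin x]
    refine ⟨η / 2 * ‖d‖ ^ 2, fun t => le_of_eq ?_⟩
    have e : p + t • d - c = (p - c) + t • d := by abel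
    rw [e, norm_add_sq_real, norm_smul, inner_smul_right, inner_smul_left, mul_pow,
      Real.norm_eq_abs, sq_abs]
    simp only [conj_trivial]
    ring
  rwa [← smul_neg, neg_sub] at h

lemma isSubgradient_of_tendsto {f : E → ℝ} (hf : Continuous f) {p s : ℕ → E} {p' s' : E}
    (h : ∀ n, IsSubgradient f (p n) (s n)) (hp : Tendsto p atTop (𝓝 p'))
    (hs : Tendsto s atTop (𝓝 s')) : IsSubgradient f p' s' := fun x =>
  le_of_tendsto' (((hf.tendsto p').comp hp).add (hs.inner (tendsto_const_nhds.sub hp)))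
    fun n => h n x

/-- The proximal map is nonexpansive. -/
lemma norm_sub_le_of_isSubgradient {f : E → ℝ} {η : ℝ} (hη : 0 < η) {p q a b : E}
    (hp : IsSubgradient f p (η • (a - p))) (hq : IsSubgradient f q (η • (b - q))) :
    ‖p - q‖ ≤ ‖a - b‖ := by
  have h := hp.inner_sub_nonneg hq
  have e : η • (a - p) - η • (b - q) = η • ((a - b) - (p - q)) := by module
  rw [e, inner_smul_left, inner_sub_left, real_inner_self_eq_norm_sq] at h
  have h1 := nonneg_of_mul_nonneg_right h hη
  have h2 := real_inner_le_norm (a - b) (p - q)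
  by_contra! hlt
  nlinarith [norm_nonneg (p - q), norm_nonneg (a - b)]

end Subgradient

/-! ### The inexact Douglas–Rachford iteration -/

section DouglasRachford

variable {E : Type*} [NormedAddCommGroup E] [InnerProductSpace ℝ E]

/-- The Douglas–Rachford step `w ↦ w - z + q` is firmly nonexpansive relative to a fixed point `ws`, that
is, a point whose proximal point `p` for `h` is also the proximal point of `2 p - ws` for `g`. -/
lemma douglasRachford_step {g h : E → ℝ} {η : ℝ} (hη : 0 < η) {w z q ws p : E}
    (hz : IsSubgradient h z (η • (w - z))) (hq : IsSubgradient g q (η • ((2 : ℝ) • z - w - q)))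
    (hps : IsSubgradient h p (η • (ws - p))) (hpg : IsSubgradient g p (η • (p - ws))) :
    ‖w - z + q - ws‖ ^ 2 + ‖z - q‖ ^ 2 ≤ ‖w - ws‖ ^ 2 := by
  have h1 := hz.inner_sub_nonneg hps
  have h2 := hq.inner_sub_nonneg hpg
  obtain ⟨a, rfl⟩ : ∃ a, w = a + ws := ⟨w - ws, by abel⟩
  obtain ⟨b, rfl⟩ : ∃ b, z = b + p := ⟨z - p, by abel⟩
  obtain ⟨c, rfl⟩ : ∃ c, q = c + p := ⟨q - p, by abel⟩
  have e1 : η • (a + ws - (b + p)) - η • (ws - p) = η • (a - b) := by module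
  have e2 : η • ((2 : ℝ) • (b + p) - (a + ws) - (c + p)) - η • (p - ws)
      = η • ((2 : ℝ) • b - a - c) := by module
  have e3 : a + ws - (b + p) + (c + p) - ws = a - (b - c) := by abel
  rw [e1, inner_smul_left, add_sub_cancel_right] at h1
  rw [e2, inner_smul_left, add_sub_cancel_right] at h2
  have h3 := nonneg_of_mul_nonneg_right h1 hη
  have h4 := nonneg_of_mul_nonneg_right h2 hη
  rw [e3, add_sub_add_right_eq_sub, add_sub_cancel_right, norm_sub_sq_real a, norm_sub_sq_real b,
    inner_sub_right]
  rw [inner_sub_left, real_inner_self_eq_norm_sq] at h3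
  rw [inner_sub_left, inner_sub_left, inner_smul_left, real_inner_self_eq_norm_sq] at h4
  simp only [conj_trivial] at h4
  linarith

/-- A nonnegative sequence that is nonincreasing up to summable errors converges. -/
lemma exists_tendsto_of_le_add_summable {d e : ℕ → ℝ} (hd : ∀ n, 0 ≤ d n) (he0 : ∀ n, 0 ≤ e n)
    (he : Summable e) (h : ∀ n, d (n + 1) ≤ d n + e n) : ∃ L, Tendsto d atTop (𝓝 L) := by
  have hanti : Antitone fun n => d n - ∑ i ∈ Finset.range n, e i := by
    refine antitone_nat_of_succ_le fun n => ?_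
    rw [Finset.sum_range_succ]
    linarith [h n]
  have hbdd : BddBelow (Set.range fun n => d n - ∑ i ∈ Finset.range n, e i) := by
    refine ⟨-∑' i, e i, ?_⟩
    rintro _ ⟨n, rfl⟩
    have := he.sum_le_tsum (Finset.range n) fun i _ => he0 i
    simp only
    linarith [hd n]
  have h1 := (tendsto_atTop_ciInf hanti hbdd).add he.hasSum.tendsto_sum_nat
  simp only [sub_add_cancel] at h1
  exact ⟨_, h1⟩

/-- Quasi-Fejér property of the inexact iteration: its distance to any fixed point converges, and the
steps of the exact operator tend to zero. -/
lemma tendsto_norm_sub_of_inexact_douglasRachford {g h : E → ℝ} {η : ℝ} (hη : 0 < η)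
    {w z q : ℕ → E} (hz : ∀ n, IsSubgradient h (z n) (η • (w n - z n)))
    (hq : ∀ n, IsSubgradient g (q n) (η • ((2 : ℝ) • z n - w n - q n)))
    (he : Summable fun n => ‖w (n + 1) - (w n - z n + q n)‖) {ws p : E}
    (hps : IsSubgradient h p (η • (ws - p))) (hpg : IsSubgradient g p (η • (p - ws))) :
    (∃ L, Tendsto (fun n => ‖w n - ws‖) atTop (𝓝 L)) ∧
      Tendsto (fun n => z n - q n) atTop (𝓝 0) := by
  have hstep := fun n => douglasRachford_step hη (hz n) (hq n) hps hpg
  have hle : ∀ n, ‖w n - z n + q n - ws‖ ≤ ‖w n - ws‖ := fun n =>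
    le_of_sq_le_sq (by nlinarith [hstep n, sq_nonneg ‖z n - q n‖]) (norm_nonneg _)
  have hdiff : ∀ n, |‖w n - z n + q n - ws‖ - ‖w (n + 1) - ws‖|
      ≤ ‖w (n + 1) - (w n - z n + q n)‖ := fun n => by
    refine (abs_norm_sub_norm_le _ _).trans_eq ?_
    rw [sub_sub_sub_cancel_right, norm_sub_rev]
  obtain ⟨L, hL⟩ := exists_tendsto_of_le_add_summable (d := fun n => ‖w n - ws‖)
    (fun n => norm_nonneg _) (fun n => norm_nonneg _) he fun n => by
      have h1 := abs_le.1 (hdiff n)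
      linarith [h1.1, hle n]
  refine ⟨⟨L, hL⟩, ?_⟩
  have h0 := squeeze_zero_norm (fun n => (Real.norm_eq_abs _).trans_le (hdiff n)) he.tendsto_atTop_zero
  have h1 := h0.add ((tendsto_add_atTop_iff_nat 1).2 hL)
  simp only [sub_add_cancel, zero_add] at h1
  have h2 := (hL.pow 2).sub (h1.pow 2)
  rw [sub_self] at h2
  have h3 : Tendsto (fun n => ‖z n - q n‖ ^ 2) atTop (𝓝 0) :=
    squeeze_zero (fun n => sq_nonneg _) (fun n => by linarith [hstep n]) h2
  have h4 := h3.sqrt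
  simp only [Real.sqrt_sq (norm_nonneg _), Real.sqrt_zero] at h4
  exact tendsto_zero_iff_norm_tendsto_zero.2 h4

/-- Convergence of the Douglas–Rachford iteration with summable errors, given that a fixed point exists.
The proximal points are encoded by their subgradient inequalities. -/
theorem exists_tendsto_of_inexact_douglasRachford [FiniteDimensional ℝ E] {g h : E → ℝ}
    (hg : Continuous g) (hh : Continuous h) {η : ℝ} (hη : 0 < η)
    {w z q : ℕ → E} (hz : ∀ n, IsSubgradient h (z n) (η • (w n - z n)))
    (hq : ∀ n, IsSubgradient g (q n) (η • ((2 : ℝ) • z n - w n - q n)))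
    (he : Summable fun n => ‖w (n + 1) - (w n - z n + q n)‖) {ws p : E}
    (hps : IsSubgradient h p (η • (ws - p))) (hpg : IsSubgradient g p (η • (p - ws))) :
    ∃ wl zl, Tendsto w atTop (𝓝 wl) ∧ Tendsto z atTop (𝓝 zl) ∧ ∀ x, g zl + h zl ≤ g x + h x := by
  have : ProperSpace E := FiniteDimensional.proper ℝ E
  obtain ⟨⟨L, hL⟩, hzq⟩ := tendsto_norm_sub_of_inexact_douglasRachford hη hz hq he hps hpg
  -- a cluster point of `w`, along which `z` also clusters since the proximal map is nonexpansive
  obtain ⟨B, hB⟩ := hL.bddAbove_range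
  have hwB : ∀ n, w n ∈ Metric.closedBall ws B := fun n => by
    rw [mem_closedBall_iff_norm]
    exact hB ⟨n, rfl⟩
  obtain ⟨wl, -, φ, hφ, hwl⟩ := tendsto_subseq_of_bounded Metric.isBounded_closedBall hwB
  have hcauchy : CauchySeq (z ∘ φ) := by
    have hc := hwl.cauchySeq
    rw [Metric.cauchySeq_iff'] at hc ⊢
    intro ε hε
    obtain ⟨n0, hn0⟩ := hc ε hε
    refine ⟨n0, fun n hn => lt_of_le_of_lt ?_ (hn0 n hn)⟩
    rw [dist_eq_norm, dist_eq_norm]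
    exact norm_sub_le_of_isSubgradient hη (hz _) (hz _)
  obtain ⟨zl, hzl⟩ := cauchySeq_tendsto_of_complete hcauchy
  have hql : Tendsto (q ∘ φ) atTop (𝓝 zl) := by
    have h1 := hzl.sub (hzq.comp hφ.tendsto_atTop)
    simpa [Function.comp_def] using h1
  -- the cluster point is a fixed point
  have hsh : IsSubgradient h zl (η • (wl - zl)) :=
    isSubgradient_of_tendsto hh (fun n => hz (φ n)) hzl ((hwl.sub hzl).const_smul η)
  have hsg : IsSubgradient g zl (η • (zl - wl)) := by
    have e : zl - wl = (2 : ℝ) • zl - wl - zl := by module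
    rw [e]
    exact isSubgradient_of_tendsto hg (fun n => hq (φ n)) hql
      ((((hzl.const_smul (2 : ℝ)).sub hwl).sub hql).const_smul η)
  obtain ⟨⟨L', hL'⟩, -⟩ := tendsto_norm_sub_of_inexact_douglasRachford hη hz hq he hsh hsg
  have hL0 : L' = 0 :=
    tendsto_nhds_unique (hL'.comp hφ.tendsto_atTop) (tendsto_iff_norm_sub_tendsto_zero.1 hwl)
  rw [hL0] at hL'
  refine ⟨wl, zl, tendsto_iff_norm_sub_tendsto_zero.2 hL', ?_, fun x => ?_⟩
  · exact tendsto_iff_norm_sub_tendsto_zero.2 (squeeze_zero (fun n => norm_nonneg _)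
      (fun n => norm_sub_le_of_isSubgradient hη (hz n) hsh) hL')
  · have h1 := hsh x
    have h2 := hsg x
    rw [← neg_sub wl zl, smul_neg, inner_neg_left] at h2
    linarith

end DouglasRachford

/-! ### Huber's penalty -/

lemma huberPsi_of_lt {k ν r : ℝ} (hk : 0 < k) (h : k * ν ^ 2 < r) :
    huberPsi k ν r = k * ν ^ 2 := by
  have h0 : 0 ≤ k * ν ^ 2 := by positivity
  rw [huberPsi, if_neg (by rw [abs_of_pos (h0.trans_lt h)]; exact h.not_ge),
    Real.sign_of_pos (h0.trans_lt h), mul_one]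

lemma huberPsi_of_lt_neg {k ν r : ℝ} (hk : 0 < k) (h : r < -(k * ν ^ 2)) :
    huberPsi k ν r = -(k * ν ^ 2) := by
  have h0 : 0 ≤ k * ν ^ 2 := by positivity
  have hr : r < 0 := by linarith
  rw [huberPsi, if_neg (by rw [abs_of_neg hr]; linarith), Real.sign_of_neg hr, mul_neg_one]

/-- `ψ` is the projection onto `[-k ν², k ν²]`. -/
lemma huberPsi_cases {k ν : ℝ} (hk : 0 < k) (r : ℝ) :
    (|r| ≤ k * ν ^ 2 ∧ huberPsi k ν r = r) ∨ (k * ν ^ 2 ≤ r ∧ huberPsi k ν r = k * ν ^ 2) ∨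
      (r ≤ -(k * ν ^ 2) ∧ huberPsi k ν r = -(k * ν ^ 2)) := by
  by_cases h : |r| ≤ k * ν ^ 2
  · exact Or.inl ⟨h, if_pos h⟩
  · rcases lt_abs.1 (not_le.1 h) with h | h
    · exact Or.inr (Or.inl ⟨h.le, huberPsi_of_lt hk h⟩)
    · have h' : r < -(k * ν ^ 2) := by linarith
      exact Or.inr (Or.inr ⟨h'.le, huberPsi_of_lt_neg hk h'⟩)

lemma abs_huberPsi_le {k ν : ℝ} (hk : 0 < k) (r : ℝ) : |huberPsi k ν r| ≤ k * ν ^ 2 := by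
  have h0 : 0 ≤ k * ν ^ 2 := by positivity
  rcases huberPsi_cases (ν := ν) hk r with ⟨h, e⟩ | ⟨h, e⟩ | ⟨h, e⟩ <;> rw [e]
  · exact h
  · rw [abs_of_nonneg h0]
  · rw [abs_neg, abs_of_nonneg h0]

/-- The variational inequality for the projection `ψ`. -/
lemma sub_huberPsi_mul_le {k ν : ℝ} (hk : 0 < k) (r : ℝ) {a : ℝ} (ha : |a| ≤ k * ν ^ 2) :
    (r - huberPsi k ν r) * (a - huberPsi k ν r) ≤ 0 := by
  have ha' := abs_le.1 ha
  rcases huberPsi_cases (ν := ν) hk r with ⟨h, e⟩ | ⟨h, e⟩ | ⟨h, e⟩ <;> rw [e]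
  · simp
  · exact mul_nonpos_of_nonneg_of_nonpos (by linarith) (by linarith)
  · exact mul_nonpos_of_nonpos_of_nonneg (by linarith) (by linarith)

/-- The Legendre form of Huber's penalty, with the maximum over `[-k ν², k ν²]` of `a r - a² / 2`
attained at `a = ψ r`. -/
lemma huber_eq {k ν : ℝ} (hk : 0 < k) (r : ℝ) :
    huber k ν r = huberPsi k ν r * r - huberPsi k ν r ^ 2 / 2 := by
  have h0 : 0 ≤ k * ν ^ 2 := by positivity
  by_cases h : |r| ≤ k * ν ^ 2
  · rw [huber, huberPsi, if_pos h, if_pos h]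
    ring
  · rw [huber, if_neg h]
    rcases lt_abs.1 (not_le.1 h) with h | h
    · rw [huberPsi_of_lt hk h, abs_of_pos (h0.trans_lt h)]
      ring
    · rw [huberPsi_of_lt_neg hk (by linarith), abs_of_neg (by linarith)]
      ring

lemma huber_ge_linear {k ν : ℝ} (hk : 0 < k) (r s : ℝ) :
    huber k ν r + huberPsi k ν r * (s - r) ≤ huber k ν s := by
  rw [huber_eq hk, huber_eq hk]
  have h := sub_huberPsi_mul_le (ν := ν) hk s (abs_huberPsi_le hk r)
  nlinarith [sq_nonneg (huberPsi k ν s - huberPsi k ν r)]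

lemma huber_le_quadratic {k ν : ℝ} (hk : 0 < k) (r s : ℝ) :
    huber k ν s ≤ huber k ν r + huberPsi k ν r * (s - r) + (s - r) ^ 2 / 2 := by
  rw [huber_eq hk, huber_eq hk]
  have h := sub_huberPsi_mul_le (ν := ν) hk r (abs_huberPsi_le hk s)
  nlinarith [sq_nonneg (s - r - (huberPsi k ν s - huberPsi k ν r))]

lemma huber_nonneg {k ν : ℝ} (hk : 0 < k) (r : ℝ) : 0 ≤ huber k ν r := by
  have h0 : 0 ≤ k * ν ^ 2 := by positivity
  have e0 : huberPsi k ν 0 = 0 := if_pos (by simpa using h0)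
  have h := huber_ge_linear (ν := ν) hk 0 r
  rw [e0, huber_eq hk 0, e0] at h
  linarith

lemma convexOn_huber {k ν : ℝ} (hk : 0 < k) : ConvexOn ℝ Set.univ (huber k ν) := by
  refine ⟨convex_univ, fun r _ s _ a b ha hb hab => ?_⟩
  simp only [smul_eq_mul]
  have h1 := mul_le_mul_of_nonneg_left (huber_ge_linear (ν := ν) hk (a * r + b * s) r) ha
  have h2 := mul_le_mul_of_nonneg_left (huber_ge_linear (ν := ν) hk (a * r + b * s) s) hb
  obtain rfl : b = 1 - a := by linarith
  linarith

/-! ### The robust loss and the `ℓ¹` norm -/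

section Loss

variable {M N : ℕ}

lemma convexOn_robustLoss {k ν : ℝ} (hk : 0 < k) (Φ : Matrix (Fin M) (Fin N) ℝ)
    (y : EuclideanSpace ℝ (Fin M)) : ConvexOn ℝ Set.univ (robustLoss k ν Φ y) := by
  refine ⟨convex_univ, fun x _ x' _ a b ha hb hab => ?_⟩
  simp only [robustLoss, smul_eq_mul, Finset.mul_sum, ← Finset.sum_add_distrib]
  refine Finset.sum_le_sum fun i _ => ?_
  have h := (convexOn_huber (ν := ν) hk).2 (Set.mem_univ (y i - (Φ *ᵥ x.ofLp) i))
    (Set.mem_univ (y i - (Φ *ᵥ x'.ofLp) i)) ha hb hab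
  simp only [smul_eq_mul] at h
  refine le_of_eq_of_le (congrArg _ ?_) h
  obtain rfl : b = 1 - a := by linarith
  simp only [WithLp.ofLp_add, WithLp.ofLp_smul, Matrix.mulVec_add, Matrix.mulVec_smul, Pi.add_apply,
    Pi.smul_apply, smul_eq_mul]
  ring

lemma convexOn_l1Norm {lam : ℝ} (hlam : 0 ≤ lam) :
    ConvexOn ℝ Set.univ fun x : EuclideanSpace ℝ (Fin N) => lam * l1Norm x := by
  refine ⟨convex_univ, fun x _ x' _ a b ha hb _ => ?_⟩
  have h : l1Norm (a • x + b • x') ≤ a * l1Norm x + b * l1Norm x' := by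
    simp only [l1Norm, Finset.mul_sum, ← Finset.sum_add_distrib]
    refine Finset.sum_le_sum fun j _ => ?_
    simp only [PiLp.add_apply, PiLp.smul_apply, smul_eq_mul]
    refine (abs_add_le _ _).trans_eq ?_
    rw [abs_mul, abs_mul, abs_of_nonneg ha, abs_of_nonneg hb]
  simp only [smul_eq_mul]
  linarith [mul_le_mul_of_nonneg_left h hlam]

lemma _root_.ConvexOn.continuous_of_univ {f : EuclideanSpace ℝ (Fin N) → ℝ}
    (hf : ConvexOn ℝ Set.univ f) : Continuous f :=
  continuousOn_univ.1 (hf.continuousOn isOpen_univ)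

lemma norm_le_l1Norm (x : EuclideanSpace ℝ (Fin N)) : ‖x‖ ≤ l1Norm x := by
  have h0 : 0 ≤ l1Norm x := Finset.sum_nonneg fun j _ => abs_nonneg _
  rw [EuclideanSpace.norm_eq]
  exact Real.sqrt_le_iff.2 ⟨h0, Finset.sum_sq_le_sq_sum_of_nonneg fun j _ => norm_nonneg _⟩

lemma robustLoss_nonneg {k ν : ℝ} (hk : 0 < k) (Φ : Matrix (Fin M) (Fin N) ℝ)
    (y : EuclideanSpace ℝ (Fin M)) (x : EuclideanSpace ℝ (Fin N)) : 0 ≤ robustLoss k ν Φ y x :=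
  Finset.sum_nonneg fun _ _ => huber_nonneg hk _

lemma exists_isSolution {k ν lam : ℝ} (hk : 0 < k) (hlam : 0 < lam)
    (Φ : Matrix (Fin M) (Fin N) ℝ) (y : EuclideanSpace ℝ (Fin M)) :
    ∃ p, IsSolution k ν lam Φ y p := by
  have hc : Continuous fun x => robustLoss k ν Φ y x + lam * l1Norm x :=
    (convexOn_robustLoss hk Φ y).continuous_of_univ.add (convexOn_l1Norm hlam.le).continuous_of_univ
  refine hc.exists_forall_le (tendsto_atTop_mono (fun x => ?_)
    ((tendsto_norm_cocompact_atTop (E := EuclideanSpace ℝ (Fin N))).const_mul_atTop hlam))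
  have h1 := mul_le_mul_of_nonneg_left (norm_le_l1Norm x) hlam.le
  linarith [robustLoss_nonneg (ν := ν) hk Φ y x]

/-- The gradient `-Φᵀ ψ(y - Φ x)` of the robust loss. -/
noncomputable def robustGrad (k ν : ℝ) (Φ : Matrix (Fin M) (Fin N) ℝ) (y : EuclideanSpace ℝ (Fin M))
    (x : EuclideanSpace ℝ (Fin N)) : EuclideanSpace ℝ (Fin N) :=
  WithLp.toLp 2 (-(Φᵀ *ᵥ fun i => huberPsi k ν (y i - (Φ *ᵥ x.ofLp) i)))

lemma inner_robustGrad (k ν : ℝ) (Φ : Matrix (Fin M) (Fin N) ℝ) (y : EuclideanSpace ℝ (Fin M))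
    (x d : EuclideanSpace ℝ (Fin N)) : inner ℝ (robustGrad k ν Φ y x) d
      = -∑ i, huberPsi k ν (y i - (Φ *ᵥ x.ofLp) i) * (Φ *ᵥ d.ofLp) i := by
  rw [PiLp.inner_apply, robustGrad]
  change ∑ j, d.ofLp j * (-(Φᵀ *ᵥ fun i => huberPsi k ν (y i - (Φ *ᵥ x.ofLp) i))) j = _
  change d.ofLp ⬝ᵥ _ = -((fun i => huberPsi k ν (y i - (Φ *ᵥ x.ofLp) i)) ⬝ᵥ (Φ *ᵥ d.ofLp))
  rw [dotProduct_neg, Matrix.mulVec_transpose, dotProduct_comm, Matrix.dotProduct_mulVec]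

lemma isSubgradient_robustGrad {k ν : ℝ} (hk : 0 < k) (Φ : Matrix (Fin M) (Fin N) ℝ)
    (y : EuclideanSpace ℝ (Fin M)) (p : EuclideanSpace ℝ (Fin N)) :
    IsSubgradient (robustLoss k ν Φ y) p (robustGrad k ν Φ y p) := by
  intro x
  rw [inner_robustGrad]
  simp only [robustLoss, ← Finset.sum_neg_distrib, ← Finset.sum_add_distrib]
  refine Finset.sum_le_sum fun i _ => le_of_eq_of_le ?_
    (huber_ge_linear hk (y i - (Φ *ᵥ p.ofLp) i) (y i - (Φ *ᵥ x.ofLp) i))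
  rw [WithLp.ofLp_sub, Matrix.mulVec_sub, Pi.sub_apply]
  ring

lemma robustLoss_le_quadratic {k ν : ℝ} (hk : 0 < k) (Φ : Matrix (Fin M) (Fin N) ℝ)
    (y : EuclideanSpace ℝ (Fin M)) (p d : EuclideanSpace ℝ (Fin N)) (t : ℝ) :
    robustLoss k ν Φ y (p + t • d) ≤ robustLoss k ν Φ y p + t * inner ℝ (robustGrad k ν Φ y p) d
      + t ^ 2 * ∑ i, (Φ *ᵥ d.ofLp) i ^ 2 / 2 := by
  rw [inner_robustGrad]
  simp only [robustLoss, ← Finset.sum_neg_distrib, Finset.mul_sum, ← Finset.sum_add_distrib]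
  refine Finset.sum_le_sum fun i _ => ?_
  have h := huber_le_quadratic (ν := ν) hk (y i - (Φ *ᵥ p.ofLp) i)
    (y i - (Φ *ᵥ (p + t • d).ofLp) i)
  refine h.trans_eq ?_
  simp only [WithLp.ofLp_add, WithLp.ofLp_smul, Matrix.mulVec_add, Matrix.mulVec_smul, Pi.add_apply,
    Pi.smul_apply, smul_eq_mul]
  ring

end Loss

end RobustCS

/-! ### Convergence of the inexact ADMM -/

open RobustCS in
theorem theorem1 {M N : ℕ} (Φ : Matrix (Fin M) (Fin N) ℝ) (y : EuclideanSpace ℝ (Fin M))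
    (k ν lam η μ : ℝ) (hk : 0 < k) (hν : 0 < ν) (hlam : 0 < lam) (hη : 0 < η) (hμ : 0 < μ)
    (x z u xs : ℕ → EuclideanSpace ℝ (Fin N))
    (hx : ∀ n, x (n + 1) = RobustCS.mmXUpdate k ν μ η Φ y (x n) (z n) (u n))
    (hz : ∀ n, RobustCS.IsZStep lam η (x (n + 1)) (u n) (z (n + 1)))
    (hu : ∀ n, u (n + 1) = u n + x (n + 1) - z (n + 1))
    (hxs : ∀ n, RobustCS.IsExactXStep k ν η Φ y (z n) (u n) (xs (n + 1)))
    (hsum : Summable fun n => ‖x (n + 1) - xs (n + 1)‖) :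
    ∃ xhat : EuclideanSpace ℝ (Fin N),
      RobustCS.IsSolution k ν lam Φ y xhat ∧ Tendsto x atTop (𝓝 xhat) := by
  have hg := convexOn_robustLoss (ν := ν) hk Φ y
  have hh := convexOn_l1Norm (N := N) hlam.le
  obtain ⟨p, hp⟩ := exists_isSolution (ν := ν) hk hlam Φ y
  -- the fixed point with proximal point `p` is `p - η⁻¹ ∇g(p)`
  have hps := isSubgradient_neg_of_isMin hh
    (fun d => ⟨_, robustLoss_le_quadratic (ν := ν) hk Φ y p d⟩) hp
  have hpg := isSubgradient_robustGrad (ν := ν) hk Φ y p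
  set s := robustGrad k ν Φ y p
  have e1 : -s = η • ((p - η⁻¹ • s) - p) := by
    rw [sub_sub_cancel_left, smul_neg, smul_inv_smul₀ hη.ne']
  have e2 : s = η • (p - (p - η⁻¹ • s)) := by
    rw [sub_sub_cancel, smul_inv_smul₀ hη.ne']
  rw [e1] at hps
  rw [e2] at hpg
  have hw : ∀ n, z (n + 1) + u (n + 1) = u n + x (n + 1) := fun n => by rw [hu]; abel
  have hzs : ∀ n, IsSubgradient (fun x => lam * l1Norm x) (z (n + 1))
      (η • (z (n + 1) + u (n + 1) - z (n + 1))) := fun n => by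
    refine isSubgradient_of_prox hh fun x' => ?_
    have e : ∀ v, ‖v - (z (n + 1) + u (n + 1))‖ = ‖x (n + 1) - v + u n‖ := fun v => by
      rw [hw, norm_sub_rev]
      congr 1
      abel
    rw [e, e]
    exact hz n x'
  have hqs : ∀ n, IsSubgradient (robustLoss k ν Φ y) (xs (n + 2))
      (η • ((2 : ℝ) • z (n + 1) - (z (n + 1) + u (n + 1)) - xs (n + 2))) := fun n => by
    refine isSubgradient_of_prox hg fun x' => ?_
    have e : ∀ v, v - ((2 : ℝ) • z (n + 1) - (z (n + 1) + u (n + 1)))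
        = v - z (n + 1) + u (n + 1) := fun v => by module
    rw [e, e]
    exact hxs (n + 1) x'
  have herr : ∀ n, z (n + 1 + 1) + u (n + 1 + 1) - (z (n + 1) + u (n + 1) - z (n + 1) + xs (n + 2))
      = x (n + 1 + 1) - xs (n + 1 + 1) := fun n => by
    rw [hw (n + 1)]
    abel
  have hsum' : Summable fun n => ‖z (n + 1 + 1) + u (n + 1 + 1)
      - (z (n + 1) + u (n + 1) - z (n + 1) + xs (n + 2))‖ := by
    simp only [herr]
    exact (summable_nat_add_iff (f := fun n => ‖x (n + 1) - xs (n + 1)‖) 1).2 hsum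
  obtain ⟨wl, zl, hwl, hzl, hmin⟩ := exists_tendsto_of_inexact_douglasRachford
    (w := fun n => z (n + 1) + u (n + 1)) (z := fun n => z (n + 1)) (q := fun n => xs (n + 2))
    hg.continuous_of_univ hh.continuous_of_univ hη hzs hqs hsum' hps hpg
  refine ⟨zl, hmin, (tendsto_add_atTop_iff_nat 2).1 ?_⟩
  have hlim := (((tendsto_add_atTop_iff_nat 1).2 hwl).sub hwl).add hzl
  rw [sub_self, zero_add] at hlim
  refine hlim.congr fun n => ?_
  rw [hw (n + 1)]
  abel
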